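/- Let $\mathbb G$ be a Carnot group of step $\kappa\ge 1$, i.e. a nilpotent, connected and simply connected real Lie group whose Lie algebra $\mathfrak g$ of left invariant vector fields has a stratification $\mathfrak g=V_1\oplus\dots\oplus V_\kappa$ with $[V_1,V_i]=V_{i+1}$ for all $i\ge 1$, $V_\kappa\ne\{0\}$ and $V_i=\{0\}$ for $i>\kappa$, where $[V_1,V_i]$ is the span of the commutators $[X,Y]$ with $X\in V_1$, $Y\in V_i$. Fix a Haar measure $\mu$ on $\mathbb G$, and an inner product on $V_1$, given by a basis $(X_1,\dots,X_m)$ of $V_1$ that is declared orthonormal. For a $\mu$-measurable set $E\subset\mathbb G$ and $X\in\mathfrak g$, let $X\mathbb 1_E$ be the distribution $\varphi\mapsto-\int_E X\varphi\,d\mu$, $\varphi\in C_c^\infty(\mathbb G)$. The set $E$ has locally finite $\mathbb G$-perimeter if $X\mathbb 1_E$ is a (signed) Radon measure for every $X\in V_1$. In that case the perimeter measure $|\partial E|_{\mathbb G}$ is the total variation of the $\mathbb R^m$-valued Radon measure $(X_1\mathbb 1_E,\dots,X_m\mathbb 1_E)$, and the intrinsic normal of $E$ is the horizontal section $\nu_E=\sum_i(\nu_E)_iX_i$,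 defined and of length one $|\partial E|_{\mathbb G}$-almost everywhere, such that $X_i\mathbb 1_E=(\nu_E)_i\,|\partial E|_{\mathbb G}$ for $i=1,\dots,m$. We say that $E$ has a constant intrinsic normal if $E$ has locally finite $\mathbb G$-perimeter, $|\partial E|_{\mathbb G}\neq0$, and $\nu_E$ coincides $|\partial E|_{\mathbb G}$-almost everywhere with a fixed element of $V_1$. A vertical halfspace is a set $H\subset\mathbb G$ with a constant intrinsic normal such that $Y\mathbb 1_H=0$ for every $Y\in V_2\oplus\dots\oplus V_\kappa$. Suppose that $\mathbb G$ is of type $\star$, i.e. there is a basis $(Z_1,\dots,Z_m)$ of $V_1$ (in general not related to $(X_1,\dots,X_m)$) with $$[Z_j,[Z_j,Z_i]]=0\qquad\text{for all } i,j=1,\dots,m.$$ Then every set $E\subset\mathbb G$ with a constant intrinsic normal is a vertical halfspace. -/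

import Mathlib

open scoped Manifold ContDiff ENNReal
open MeasureTheory

noncomputable section

namespace Carnot

variable {n : ℕ} {G : Type*} [TopologicalSpace G] [ChartedSpace (EuclideanSpace ℝ (Fin n)) G]
  [Group G]

/-- `V 1, …, V κ` is a step `κ` stratification of the Lie algebra of `G`
(the value `V 0` plays no role). -/
structure IsStratification (κ : ℕ) (V : ℕ → Submodule ℝ (GroupLieAlgebra (𝓡 n) G)) : Prop where
  one_le : 1 ≤ κ
  isInternal : DirectSum.IsInternal fun i : Set.Icc 1 κ => V i
  bracket_eq : ∀ i, 1 ≤ i →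
    Submodule.span ℝ {Z | ∃ X ∈ V 1, ∃ Y ∈ V i, ⁅X, Y⁆ = Z} = V (i + 1)
  top_ne_bot : V κ ≠ ⊥
  eq_bot : ∀ i, κ < i → V i = ⊥

/-- A Lie group `G` is a Carnot group of step `κ` with layers `V 1, …, V κ`: it is nilpotent,
connected and simply connected, and the `V i` stratify its Lie algebra. -/
structure IsCarnotGroup (κ : ℕ) (V : ℕ → Submodule ℝ (GroupLieAlgebra (𝓡 n) G)) : Prop where
  isNilpotent : Group.IsNilpotent G
  simplyConnected : SimplyConnectedSpace G
  isStratification : IsStratification κ V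

/-- Type `⋆`: some basis `X` of the first layer satisfies `[X_j, [X_j, X_i]] = 0`. -/
def IsTypeStar (V : ℕ → Submodule ℝ (GroupLieAlgebra (𝓡 n) G)) : Prop :=
  ∃ (m : ℕ) (X : Module.Basis (Fin m) ℝ (V 1)), ∀ i j,
    ⁅(X j : GroupLieAlgebra (𝓡 n) G), ⁅(X j : GroupLieAlgebra (𝓡 n) G),
      (X i : GroupLieAlgebra (𝓡 n) G)⁆⁆ = 0

/-- The derivative of `φ` along the left invariant vector field that extends `X`. -/
def lieDeriv (X : GroupLieAlgebra (𝓡 n) G) (φ : G → ℝ) (x : G) : ℝ :=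
  mfderiv (𝓡 n) 𝓘(ℝ, ℝ) φ x (mulInvariantVectorField X x)

variable (n) in
/-- Smooth compactly supported real functions on `G`. -/
def IsTestFunction (φ : G → ℝ) : Prop :=
  ContMDiff (𝓡 n) 𝓘(ℝ, ℝ) ∞ φ ∧ HasCompactSupport φ

variable [MeasurableSpace G]

/-- The distribution `X 𝟙_E`, evaluated at a test function `φ`. -/
def indicatorDeriv (μ : Measure G) (E : Set G) (X : GroupLieAlgebra (𝓡 n) G) (φ : G → ℝ) : ℝ :=
  -∫ x in E, lieDeriv X φ x ∂μ

/-- `X 𝟙_E = 0` as a distribution. -/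
def IndicatorDerivEqZero (μ : Measure G) (E : Set G) (X : GroupLieAlgebra (𝓡 n) G) : Prop :=
  ∀ φ : G → ℝ, IsTestFunction n φ → indicatorDeriv μ E X φ = 0

/-- The distribution `X 𝟙_E` is a (signed) Radon measure, that is, a difference of two locally
finite Borel measures, neither of which has to be finite. -/
def IndicatorDerivIsRadon (μ : Measure G) (E : Set G) (X : GroupLieAlgebra (𝓡 n) G) : Prop :=
  ∃ P N : Measure G, IsLocallyFiniteMeasure P ∧ IsLocallyFiniteMeasure N ∧
    ∀ φ : G → ℝ, IsTestFunction n φ →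
      indicatorDeriv μ E X φ = ∫ x, φ x ∂P - ∫ x, φ x ∂N

/-- `E` is measurable and has locally finite `G`-perimeter. -/
def HasLocallyFinitePerimeter (μ : Measure G)
    (V : ℕ → Submodule ℝ (GroupLieAlgebra (𝓡 n) G)) (E : Set G) : Prop :=
  NullMeasurableSet E μ ∧ ∀ X ∈ V 1, IndicatorDerivIsRadon μ E X

/-- The total variation on the open set `U` of the horizontal gradient
`(X_1 𝟙_E, …, X_m 𝟙_E)`. -/
def horizontalVariation {m : ℕ} (μ : Measure G) (X : Fin m → GroupLieAlgebra (𝓡 n) G)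
    (E U : Set G) : ℝ≥0∞ :=
  ⨆ (φ : Fin m → G → ℝ) (_ : (∀ i, IsTestFunction n (φ i) ∧ tsupport (φ i) ⊆ U) ∧
      ∀ x, ∑ i, φ i x ^ 2 ≤ 1),
    ENNReal.ofReal (∑ i, indicatorDeriv μ E (X i) (φ i))

/-- `P` is the perimeter measure of `E`: the locally finite Borel measure
`|(X_1 𝟙_E, …, X_m 𝟙_E)|`. -/
def IsPerimeterMeasure {m : ℕ} (μ : Measure G) (X : Fin m → GroupLieAlgebra (𝓡 n) G)
    (E : Set G) (P : Measure G) : Prop :=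
  IsLocallyFiniteMeasure P ∧ ∀ U : Set G, IsOpen U → P U = horizontalVariation μ X E U

/-- `ν = ∑ i, ν_i X_i` is the generalized intrinsic normal of `E`, whose perimeter measure is
`P`: a measurable horizontal section, of length one `P`-almost everywhere, with
`X_i 𝟙_E = ν_i P` for all `i`. The section is given by its coordinates in the frame `X`, which is
orthonormal. -/
def IsIntrinsicNormal {m : ℕ} (μ : Measure G) (X : Fin m → GroupLieAlgebra (𝓡 n) G)
    (E : Set G) (P : Measure G) (ν : G → EuclideanSpace ℝ (Fin m)) : Prop :=
  AEMeasurable ν P ∧ (∀ᵐ x ∂P, ‖ν x‖ = 1) ∧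
    ∀ i, ∀ φ : G → ℝ, IsTestFunction n φ →
      indicatorDeriv μ E (X i) φ = ∫ x, φ x * ν x i ∂P

/-- `E` is a set of locally finite perimeter, its perimeter is not null, and its intrinsic normal
is constant. The basis `X` of the first layer fixes the inner product of that layer. -/
def HasConstantIntrinsicNormal {m : ℕ} (μ : Measure G)
    (V : ℕ → Submodule ℝ (GroupLieAlgebra (𝓡 n) G)) (X : Module.Basis (Fin m) ℝ (V 1))
    (E : Set G) : Prop :=
  HasLocallyFinitePerimeter μ V E ∧
    ∃ (P : Measure G) (ν : G → EuclideanSpace ℝ (Fin m)),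
      IsPerimeterMeasure μ (fun i => (X i : GroupLieAlgebra (𝓡 n) G)) E P ∧ P ≠ 0 ∧
      IsIntrinsicNormal μ (fun i => (X i : GroupLieAlgebra (𝓡 n) G)) E P ν ∧
      ∃ v : EuclideanSpace ℝ (Fin m), ∀ᵐ x ∂P, ν x = v

/-- A vertical halfspace: a set with constant intrinsic normal whose indicator is annihilated by
`V 2 ⊕ … ⊕ V κ`. -/
def IsVerticalHalfspace {m : ℕ} (μ : Measure G) (κ : ℕ)
    (V : ℕ → Submodule ℝ (GroupLieAlgebra (𝓡 n) G)) (X : Module.Basis (Fin m) ℝ (V 1))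
    (E : Set G) : Prop :=
  HasConstantIntrinsicNormal μ V X E ∧
    ∀ Y ∈ ⨆ i ∈ Set.Icc 2 κ, V i, IndicatorDerivEqZero μ E Y

end Carnot

end

/-! Constancy of the normal says that `Y 𝟙_E = l(Y) P` for `Y ∈ V 1`, with one positive measure `P`
and one nonzero linear form `l` (`HasConstantIntrinsicNormal.exists_linearMap`). Choose `k` with
`l(Z_k) ≠ 0`; then `Z_k` and the `w_i = l(Z_k) Z_i - l(Z_i) Z_k ∈ ker l` span `V 1`, and `w_i 𝟙_E =
0`.

The analytic core is `indicatorDerivEqZero_lie_of_lie_lie_eq_zero`. For `Z = Z_k`, `W = w_i`, type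
`⋆` gives `[[Z, W], W] = 0`; applied to `𝟙_E` this yields `W² P = 0`. Hence `P` is affine in time
along the flow of `W`; being positive for all times, it is constant, so `W P = 0` and therefore `[Z,
W] 𝟙_E = 0`.

The fields that annihilate `𝟙_E` form a Lie algebra, which now contains all `w_i` and `[Z_k, w_i]`.
Since `[Z_k, [Z_k, w_i]] = 0`, the subalgebra generated by these elements is stable under `ad Z_k`,
hence under brackets with `V 1`, and so contains every layer from the second on
(`LieSubalgebra.layer_le_of_lie_lie_eq_zero`). -/

open scoped Topology

/-! ### Vector fields as derivations on a manifold. -/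

section VectorFieldAction

open VectorField Set

variable {F : Type*} [NormedAddCommGroup F] [NormedSpace ℝ F]
  {M : Type*} [TopologicalSpace M] [ChartedSpace F M]

/-- The derivative of `g` along the vector field `V`. -/
noncomputable def derivAlong (V : Π z : M, TangentSpace 𝓘(ℝ, F) z) (g : M → ℝ) (x : M) : ℝ :=
  mfderiv 𝓘(ℝ, F) 𝓘(ℝ, ℝ) g x (V x)

/-- In a chart, differentiating along the pulled back vector field is differentiating along the
vector field. -/
theorem fderiv_comp_extChartAt_symm_apply_mpullbackWithin [IsManifold 𝓘(ℝ, F) 1 M] {x : M} {y : F}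
    (hy : y ∈ (extChartAt 𝓘(ℝ, F) x).target) (V : Π z : M, TangentSpace 𝓘(ℝ, F) z) {g : M → ℝ}
    (hg : MDifferentiableAt 𝓘(ℝ, F) 𝓘(ℝ, ℝ) g ((extChartAt 𝓘(ℝ, F) x).symm y)) :
    fderiv ℝ (g ∘ (extChartAt 𝓘(ℝ, F) x).symm) y
        (mpullbackWithin 𝓘(ℝ, F) 𝓘(ℝ, F) (extChartAt 𝓘(ℝ, F) x).symm V (range 𝓘(ℝ, F)) y) =
      derivAlong V g ((extChartAt 𝓘(ℝ, F) x).symm y) := by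
  have hinv : (mfderivWithin 𝓘(ℝ, F) 𝓘(ℝ, F) (extChartAt 𝓘(ℝ, F) x).symm
      (range 𝓘(ℝ, F)) y).IsInvertible := isInvertible_mfderivWithin_extChartAt_symm hy
  have hd : MDifferentiableAt 𝓘(ℝ, F) 𝓘(ℝ, F) (extChartAt 𝓘(ℝ, F) x).symm y := by
    have := mdifferentiableWithinAt_extChartAt_symm (I := 𝓘(ℝ, F)) hy
    simpa [mdifferentiableWithinAt_univ] using this
  rw [← mfderiv_eq_fderiv, mfderiv_comp y hg hd, mpullbackWithin_apply]
  simp only [modelWithCornersSelf_coe, range_id, mfderivWithin_univ] at hinv ⊢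
  change mfderiv 𝓘(ℝ, F) 𝓘(ℝ, ℝ) g _ (mfderiv 𝓘(ℝ, F) 𝓘(ℝ, F) (extChartAt 𝓘(ℝ, F) x).symm y _) =
    mfderiv 𝓘(ℝ, F) 𝓘(ℝ, ℝ) g _ _
  congr 1
  exact hinv.self_apply_inverse _

/-- The Lie bracket of two vector fields acts on functions as the commutator of the two
derivations. -/
theorem derivAlong_mlieBracket [CompleteSpace F] [IsManifold 𝓘(ℝ, F) 2 M]
    {V W : Π z : M, TangentSpace 𝓘(ℝ, F) z} {x : M} {g : M → ℝ}
    (hV : MDifferentiable 𝓘(ℝ, F) 𝓘(ℝ, F).tangent (fun z => (V z : TangentBundle 𝓘(ℝ, F) M)))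
    (hW : MDifferentiable 𝓘(ℝ, F) 𝓘(ℝ, F).tangent (fun z => (W z : TangentBundle 𝓘(ℝ, F) M)))
    (hg : ContMDiff 𝓘(ℝ, F) 𝓘(ℝ, ℝ) 2 g)
    (hVg : MDifferentiable 𝓘(ℝ, F) 𝓘(ℝ, ℝ) (derivAlong V g))
    (hWg : MDifferentiable 𝓘(ℝ, F) 𝓘(ℝ, ℝ) (derivAlong W g)) :
    derivAlong (mlieBracket 𝓘(ℝ, F) V W) g x =
      derivAlong V (derivAlong W g) x - derivAlong W (derivAlong V g) x := by
  have : IsManifold 𝓘(ℝ, F) 1 M := IsManifold.of_le (n := 2) (by norm_num)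
  set e := extChartAt 𝓘(ℝ, F) x with he
  set V' : F → F := mpullbackWithin 𝓘(ℝ, F) 𝓘(ℝ, F) e.symm V (range 𝓘(ℝ, F))
  set W' : F → F := mpullbackWithin 𝓘(ℝ, F) 𝓘(ℝ, F) e.symm W (range 𝓘(ℝ, F))
  have hg1 : MDifferentiable 𝓘(ℝ, F) 𝓘(ℝ, ℝ) g := hg.mdifferentiable (by norm_num)
  have hx : e x ∈ e.target := mem_extChartAt_target x
  have hxe : e.symm (e x) = x := extChartAt_to_inv x
  have htgt : e.target ∈ 𝓝 (e x) := extChartAt_target_mem_nhds x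
  have hs : e.symm ⁻¹' univ ∩ range 𝓘(ℝ, F) = univ := by simp
  have hdV : DifferentiableAt ℝ V' (e x) := by
    have := (hV x).mdifferentiableWithinAt (s := univ)
      |>.differentiableWithinAt_mpullbackWithin_vectorField
    rw [hs] at this
    exact differentiableWithinAt_univ.1 this
  have hdW : DifferentiableAt ℝ W' (e x) := by
    have := (hW x).mdifferentiableWithinAt (s := univ)
      |>.differentiableWithinAt_mpullbackWithin_vectorField
    rw [hs] at this
    exact differentiableWithinAt_univ.1 this
  have hg2 : ContDiffAt ℝ 2 (g ∘ e.symm) (e x) := by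
    have h1 : ContMDiffAt 𝓘(ℝ, F) 𝓘(ℝ, F) 2 e.symm (e x) :=
      (contMDiffOn_extChartAt_symm x).contMDiffAt htgt
    exact (hg.contMDiffAt.comp (e x) h1).contDiffAt
  have key : ∀ (U : Π z : M, TangentSpace 𝓘(ℝ, F) z),
      (fun y => fderiv ℝ (g ∘ e.symm) y
        (mpullbackWithin 𝓘(ℝ, F) 𝓘(ℝ, F) e.symm U (range 𝓘(ℝ, F)) y)) =ᶠ[𝓝 (e x)]
      derivAlong U g ∘ e.symm := by
    intro U
    filter_upwards [htgt] with y hy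
    exact fderiv_comp_extChartAt_symm_apply_mpullbackWithin hy U (hg1 _)
  have hbr := fderiv_apply_lieBracket hg2 (by simp) hdW hdV
  rw [(key W).fderiv_eq, (key V).fderiv_eq,
    fderiv_comp_extChartAt_symm_apply_mpullbackWithin hx V (hWg _),
    fderiv_comp_extChartAt_symm_apply_mpullbackWithin hx W (hVg _), ← he, hxe] at hbr
  rw [← hbr]
  -- The manifold bracket is the bracket in the chart, pulled back by the inverse of the derivative
  -- of `e`; writing `g` through `e` makes that inverse cancel.
  have hgx : g =ᶠ[𝓝 x] (g ∘ e.symm) ∘ e := by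
    filter_upwards [extChartAt_source_mem_nhds (I := 𝓘(ℝ, F)) x] with z hz
    exact congrArg g ((extChartAt 𝓘(ℝ, F) x).left_inv hz).symm
  have hge : MDifferentiableAt 𝓘(ℝ, F) 𝓘(ℝ, ℝ) (g ∘ e.symm) (e x) :=
    (hg2.differentiableAt (by norm_num)).mdifferentiableAt
  have hexd : MDifferentiableAt 𝓘(ℝ, F) 𝓘(ℝ, F) e x :=
    mdifferentiableAt_extChartAt (mem_chart_source F x)
  have hinv : (mfderiv 𝓘(ℝ, F) 𝓘(ℝ, F) e x).IsInvertible :=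
    isInvertible_mfderiv_extChartAt (mem_extChartAt_source x)
  rw [derivAlong, hgx.mfderiv_eq, mfderiv_comp x hge hexd, mfderiv_eq_fderiv,
    ← mlieBracketWithin_univ, mlieBracketWithin_apply, hs]
  have hlb : lieBracketWithin ℝ V' W' univ (e x) = lieBracket ℝ V' W' (e x) :=
    congrFun lieBracketWithin_univ _
  have hid : ∀ w : F, mfderiv 𝓘(ℝ, F) 𝓘(ℝ, F) e x ((mfderiv 𝓘(ℝ, F) 𝓘(ℝ, F) e x).inverse w) = w :=
    hinv.self_apply_inverse
  exact congrArg (fderiv ℝ (g ∘ e.symm) (e x)) ((hid _).trans hlb)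

/-- The derivative of a smooth function along a smooth vector field is smooth. -/
theorem contMDiff_derivAlong [IsManifold 𝓘(ℝ, F) ∞ M] {V : Π z : M, TangentSpace 𝓘(ℝ, F) z}
    (hV : ContMDiff 𝓘(ℝ, F) 𝓘(ℝ, F).tangent ∞ (fun z => (V z : TangentBundle 𝓘(ℝ, F) M)))
    {g : M → ℝ} (hg : ContMDiff 𝓘(ℝ, F) 𝓘(ℝ, ℝ) ∞ g) :
    ContMDiff 𝓘(ℝ, F) 𝓘(ℝ, ℝ) ∞ (derivAlong V g) :=
  (contMDiff_snd_tangentBundle_modelSpace ℝ 𝓘(ℝ, ℝ)).comp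
    ((hg.contMDiff_tangentMap (m := ∞) (by simp)).comp hV)

end VectorFieldAction

/-! ### Left invariant vector fields and their one-parameter groups. -/

section InvariantVectorField

open Set Function Bundle

variable {F : Type*} [NormedAddCommGroup F] [NormedSpace ℝ F]
  {G : Type*} [TopologicalSpace G] [ChartedSpace F G] [Group G] [LieGroup 𝓘(ℝ, F) ∞ G]

theorem contMDiff_infty_mulInvariantVectorField (v : GroupLieAlgebra 𝓘(ℝ, F) G) :
    ContMDiff 𝓘(ℝ, F) 𝓘(ℝ, F).tangent ∞
      (fun g : G => (mulInvariantVectorField v g : TangentBundle 𝓘(ℝ, F) G)) := by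
  have : IsManifold 𝓘(ℝ, F) ∞ G := inferInstance
  have S₁ : ContMDiff 𝓘(ℝ, F) (𝓘(ℝ, F).tangent.prod 𝓘(ℝ, F).tangent) ∞
      (fun g : G => ((TotalSpace.mk' F g 0 : TangentBundle 𝓘(ℝ, F) G),
        (TotalSpace.mk' F 1 v : TangentBundle 𝓘(ℝ, F) G))) :=
    (contMDiff_zeroSection _ _).prodMk contMDiff_const
  have S₂ : ContMDiff (𝓘(ℝ, F).tangent.prod 𝓘(ℝ, F).tangent)
      (𝓘(ℝ, F).prod 𝓘(ℝ, F)).tangent ∞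
      (equivTangentBundleProd 𝓘(ℝ, F) G 𝓘(ℝ, F) G).symm := contMDiff_equivTangentBundleProd_symm
  have S₃ : ContMDiff (𝓘(ℝ, F).prod 𝓘(ℝ, F)).tangent 𝓘(ℝ, F).tangent ∞
      (tangentMap (𝓘(ℝ, F).prod 𝓘(ℝ, F)) 𝓘(ℝ, F) (fun p : G × G => p.1 * p.2)) :=
    (contMDiff_mul 𝓘(ℝ, F) ∞).contMDiff_tangentMap (by simp)
  have heq : (fun g : G => (mulInvariantVectorField v g : TangentBundle 𝓘(ℝ, F) G)) =
      (tangentMap (𝓘(ℝ, F).prod 𝓘(ℝ, F)) 𝓘(ℝ, F) (fun p : G × G => p.1 * p.2)) ∘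
      (equivTangentBundleProd 𝓘(ℝ, F) G 𝓘(ℝ, F) G).symm ∘
      (fun g : G => ((TotalSpace.mk' F g 0 : TangentBundle 𝓘(ℝ, F) G),
        (TotalSpace.mk' F 1 v : TangentBundle 𝓘(ℝ, F) G))) := by
    ext1 g
    have h := fun w : F => mfderiv_prod_eq_add_apply (p := (g, (1 : G))) (v := ((0 : F), w))
      ((contMDiff_mul 𝓘(ℝ, F) (G := G) ∞).mdifferentiableAt (by simp))
    refine TotalSpace.ext (mul_one g).symm (heq_of_eq ?_)
    refine Eq.trans ?_ (h v).symm
    change _ = mfderiv 𝓘(ℝ, F) 𝓘(ℝ, F) (fun z : G => z * 1) g 0 + _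
    have h0 := map_zero (mfderiv 𝓘(ℝ, F) 𝓘(ℝ, F) (fun z : G => z * 1) g)
    exact ((congrArg (· + _) h0).trans (zero_add _)).symm
  rw [heq]
  exact S₃.comp (S₂.comp S₁)

/-- Left translations map a left invariant vector field to itself. -/
theorem mfderiv_mul_left_mulInvariantVectorField (v : GroupLieAlgebra 𝓘(ℝ, F) G) (x y : G) :
    mfderiv 𝓘(ℝ, F) 𝓘(ℝ, F) (x * ·) y (mulInvariantVectorField v y) =
      mulInvariantVectorField v (x * y) := by
  have hd : ∀ a b : G, MDifferentiableAt 𝓘(ℝ, F) 𝓘(ℝ, F) (a * ·) b := fun a b =>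
    (contMDiff_mul_left (I := 𝓘(ℝ, F)) (n := ∞) (a := a)).mdifferentiableAt (by simp)
  have hc : (fun z : G => x * y * z) = (x * ·) ∘ (y * ·) := by ext z; simp [mul_assoc]
  have h := mfderiv_comp (1 : G) (hd x (y * 1)) (hd y 1)
  -- The chain rule produces the base point `y * 1`; every tangent space is the model space `F`, so
  -- it can be replaced by `y`.
  have hy : ∀ z, y = z → ∀ w : F, (mfderiv 𝓘(ℝ, F) 𝓘(ℝ, F) (x * ·) y : F →L[ℝ] F) w =
      (mfderiv 𝓘(ℝ, F) 𝓘(ℝ, F) (x * ·) z : F →L[ℝ] F) w := by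
    rintro _ rfl w
    rfl
  rw [mulInvariantVectorField, mulInvariantVectorField, hc, h]
  exact hy _ (mul_one y).symm _

theorem IsMIntegralCurveOn.mul_left {v : GroupLieAlgebra 𝓘(ℝ, F) G} {γ : ℝ → G} {s : Set ℝ}
    (hγ : IsMIntegralCurveOn γ (mulInvariantVectorField v) s) (x : G) :
    IsMIntegralCurveOn (fun t => x * γ t) (mulInvariantVectorField (I := 𝓘(ℝ, F)) v) s := by
  intro t ht
  have hd : HasMFDerivAt 𝓘(ℝ, F) 𝓘(ℝ, F) (x * ·) (γ t) _ :=
    ((contMDiff_mul_left (I := 𝓘(ℝ, F)) (n := ∞) (a := x)).mdifferentiableAt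
      (by simp)).hasMFDerivAt
  have := hd.comp_hasMFDerivWithinAt t (hγ t ht)
  rw [← mfderiv_mul_left_mulInvariantVectorField]
  refine this.congr_mfderiv ?_
  ext
  exact ContinuousLinearMap.map_smul (mfderiv 𝓘(ℝ, F) 𝓘(ℝ, F) (x * ·) (γ t)) _ _

/-- Left translates of one local integral curve through `1` start at every point and live on the
same interval, so the field is complete. The group law is uniqueness of integral curves: both sides
solve the same equation in `t` with value `γ s` at `0`. -/
theorem exists_oneParameterSubgroup [CompleteSpace F] [T2Space G] (v : GroupLieAlgebra 𝓘(ℝ, F) G) :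
    ∃ γ : ℝ → G, IsMIntegralCurve γ (mulInvariantVectorField v) ∧ γ 0 = 1 ∧
      ∀ s t, γ (s + t) = γ s * γ t := by
  have : IsManifold 𝓘(ℝ, F) ∞ G := inferInstance
  have : IsManifold 𝓘(ℝ, F) 1 G := IsManifold.of_le (n := ∞) (by simp)
  have hv := (contMDiff_infty_mulInvariantVectorField v).of_le (n := ∞) (m := 1) (by simp)
  obtain ⟨γ₀, h0, hγ₀⟩ := exists_isMIntegralCurveAt_of_contMDiffAt_boundaryless (t₀ := 0)
    (hv.contMDiffAt (x := 1))
  obtain ⟨ε, hε, hγ₀⟩ := isMIntegralCurveAt_iff'.1 hγ₀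
  rw [Real.ball_eq_Ioo, zero_sub, zero_add] at hγ₀
  obtain ⟨γ, hγ0, hγ⟩ := exists_isMIntegralCurve_of_isMIntegralCurveOn hv hε
    (fun x => ⟨fun t => x * γ₀ t, by simp [h0], hγ₀.mul_left x⟩) 1
  refine ⟨γ, hγ, hγ0, fun s t => ?_⟩
  have h1 : IsMIntegralCurve (fun t => γ s * γ t) (mulInvariantVectorField v) := by
    rw [isMIntegralCurve_iff_isMIntegralCurveOn] at hγ ⊢
    exact hγ.mul_left _
  have h2 := isMIntegralCurve_Ioo_eq_of_contMDiff_boundaryless (t₀ := 0) hv (hγ.comp_add s) h1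
    (by simp [hγ0])
  simpa [add_comm] using congrFun h2 t

/-- The derivative of a function along the orbits of the one-parameter group generated by `v`. -/
theorem IsMIntegralCurve.hasDerivAt_comp_mul_left {v : GroupLieAlgebra 𝓘(ℝ, F) G} {γ : ℝ → G}
    (hγ : IsMIntegralCurve γ (mulInvariantVectorField v)) {g : G → ℝ}
    (hg : MDifferentiable 𝓘(ℝ, F) 𝓘(ℝ, ℝ) g) (x : G) (t : ℝ) :
    HasDerivAt (fun s => g (x * γ s)) (derivAlong (mulInvariantVectorField v) g (x * γ t)) t := by
  have h1 : IsMIntegralCurve (fun t => x * γ t) (mulInvariantVectorField v) := by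
    rw [isMIntegralCurve_iff_isMIntegralCurveOn] at hγ ⊢
    exact hγ.mul_left _
  have h2 := (hg (x * γ t)).hasMFDerivAt.comp t (h1 t)
  have h3 : (mfderiv 𝓘(ℝ, F) 𝓘(ℝ, ℝ) g (x * γ t)).comp
      ((1 : ℝ →L[ℝ] ℝ).smulRight (mulInvariantVectorField v (x * γ t))) =
      (1 : ℝ →L[ℝ] ℝ).smulRight (derivAlong (mulInvariantVectorField v) g (x * γ t)) := by
    ext
    exact ContinuousLinearMap.map_smul (mfderiv 𝓘(ℝ, F) 𝓘(ℝ, ℝ) g (x * γ t)) _ _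
  exact hasDerivAt_iff_hasFDerivAt.2 ((h2.congr_mfderiv h3).hasFDerivAt)

end InvariantVectorField

/-! ### Derivatives of test functions and of integrals along flows. -/

namespace Carnot

section LieDeriv

variable {n : ℕ} {G : Type*} [TopologicalSpace G] [ChartedSpace (EuclideanSpace ℝ (Fin n)) G]

theorem IsTestFunction.continuous {φ : G → ℝ} (hφ : IsTestFunction n φ) : Continuous φ :=
  hφ.1.continuous

theorem IsTestFunction.mdifferentiable {φ : G → ℝ} (hφ : IsTestFunction n φ) :
    MDifferentiable (𝓡 n) 𝓘(ℝ, ℝ) φ :=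
  hφ.1.mdifferentiable (by simp)

theorem IsTestFunction.integrable [MeasurableSpace G] [OpensMeasurableSpace G] {φ : G → ℝ}
    (hφ : IsTestFunction n φ) (μ : Measure G) [IsFiniteMeasureOnCompacts μ] : Integrable φ μ :=
  hφ.continuous.integrable_of_hasCompactSupport hφ.2

variable [Group G]

theorem lieDeriv_add (X Y : GroupLieAlgebra (𝓡 n) G) (φ : G → ℝ) :
    lieDeriv (X + Y) φ = lieDeriv X φ + lieDeriv Y φ := by
  ext x
  rw [lieDeriv, mulInvariantVectorField_add]
  exact ContinuousLinearMap.map_add (mfderiv (𝓡 n) 𝓘(ℝ, ℝ) φ x) _ _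

theorem lieDeriv_smul (c : ℝ) (X : GroupLieAlgebra (𝓡 n) G) (φ : G → ℝ) :
    lieDeriv (c • X) φ = c • lieDeriv X φ := by
  ext x
  rw [lieDeriv, mulInvariantVectorField_smul]
  exact ContinuousLinearMap.map_smul (mfderiv (𝓡 n) 𝓘(ℝ, ℝ) φ x) _ _

theorem support_lieDeriv_subset (X : GroupLieAlgebra (𝓡 n) G) (φ : G → ℝ) :
    Function.support (lieDeriv X φ) ⊆ tsupport φ := by
  intro x hx
  by_contra h
  refine hx ?_
  have h0 : mfderiv (𝓡 n) 𝓘(ℝ, ℝ) φ x = mfderiv (𝓡 n) 𝓘(ℝ, ℝ) (fun _ : G => (0 : ℝ)) x :=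
    (notMem_tsupport_iff_eventuallyEq.1 h).mfderiv_eq
  rw [lieDeriv, h0, mfderiv_const]
  rfl

variable [LieGroup (𝓡 n) ∞ G]

instance lieGroup_minSmoothness : LieGroup (𝓡 n) (minSmoothness ℝ 3) G :=
  LieGroup.of_le (n := ∞) (by rw [minSmoothness_of_isRCLikeNormedField]; exact ENat.LEInfty.out)

theorem IsTestFunction.lieDeriv {φ : G → ℝ} (hφ : IsTestFunction n φ)
    (X : GroupLieAlgebra (𝓡 n) G) : IsTestFunction n (lieDeriv X φ) := by
  refine ⟨?_, hφ.2.mono' (support_lieDeriv_subset X φ)⟩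
  have : IsManifold (𝓡 n) ∞ G := inferInstance
  exact contMDiff_derivAlong (contMDiff_infty_mulInvariantVectorField X) hφ.1

theorem IsTestFunction.comp_mul_right {φ : G → ℝ} (hφ : IsTestFunction n φ) (g : G) :
    IsTestFunction n (fun x => φ (x * g)) := by
  have : IsTopologicalGroup G := topologicalGroup_of_lieGroup (𝓡 n) ∞
  exact ⟨hφ.1.comp (contMDiff_mul_right (I := 𝓡 n)), hφ.2.comp_homeomorph (Homeomorph.mulRight g)⟩

/-- Brackets of left invariant vector fields act as commutators on test functions. -/
theorem lieDeriv_lie (X Y : GroupLieAlgebra (𝓡 n) G) {φ : G → ℝ} (hφ : IsTestFunction n φ) :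
    lieDeriv ⁅X, Y⁆ φ = lieDeriv X (lieDeriv Y φ) - lieDeriv Y (lieDeriv X φ) := by
  have : IsManifold (𝓡 n) 2 G := IsManifold.of_le (n := ∞) ENat.LEInfty.out
  ext x
  have h := derivAlong_mlieBracket (x := x)
    (mdifferentiable_mulInvariantVectorField X) (mdifferentiable_mulInvariantVectorField Y)
    (hφ.1.of_le ENat.LEInfty.out) (hφ.lieDeriv X).mdifferentiable
    (hφ.lieDeriv Y).mdifferentiable
  rw [← mulInvariantVector_mlieBracket] at h
  exact h

/-- Left invariant derivatives commute with right translations along the one-parameter group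
they generate. -/
theorem lieDeriv_comp_mul_right {W : GroupLieAlgebra (𝓡 n) G} {γ : ℝ → G}
    (hγ : IsMIntegralCurve γ (mulInvariantVectorField W)) (h0 : γ 0 = 1)
    (hadd : ∀ s t, γ (s + t) = γ s * γ t) {φ : G → ℝ} (hφ : IsTestFunction n φ) (s : ℝ) :
    lieDeriv W (fun x => φ (x * γ s)) = fun x => lieDeriv W φ (x * γ s) := by
  ext x
  have h1 := hγ.hasDerivAt_comp_mul_left (hφ.comp_mul_right (γ s)).mdifferentiable x 0
  have h2 := hγ.hasDerivAt_comp_mul_left hφ.mdifferentiable (x * γ s) 0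
  have heq : (fun t => φ (x * γ t * γ s)) = fun t => φ (x * γ s * γ t) := by
    ext t
    rw [mul_assoc, mul_assoc, ← hadd, ← hadd, add_comm]
  rw [heq] at h1
  have := h1.unique h2
  rwa [h0, mul_one, mul_one] at this

/-- A bound of `|φ|` times a cutoff equal to one on the support. The majorant must itself be a test
function, so that its integrals along a flow can be differentiated. -/
theorem exists_isTestFunction_abs_le [T2Space G] [SecondCountableTopology G] {φ : G → ℝ}
    (hφ : IsTestFunction n φ) : ∃ χ : G → ℝ, IsTestFunction n χ ∧ ∀ x, |φ x| ≤ χ x := by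
  have : IsManifold (𝓡 n) ∞ G := inferInstance
  have : LocallyCompactSpace G := Manifold.locallyCompact_of_finiteDimensional (𝓡 n)
  have : SigmaCompactSpace G := inferInstance
  obtain ⟨C, hC⟩ := hφ.continuous.bounded_above_of_compact_support hφ.2
  obtain ⟨K, hK, hsub⟩ := exists_compact_superset hφ.2
  obtain ⟨f, hf1, hf0, hf⟩ := exists_contMDiffMap_one_nhds_of_subset_interior (𝓡 n) (n := ⊤)
    (isClosed_tsupport φ) hsub
  refine ⟨fun x => C * f x, ⟨contMDiff_const.mul f.contMDiff, ?_⟩, fun x => ?_⟩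
  · refine HasCompactSupport.intro hK fun x hx => ?_
    simp [hf0 x hx]
  · by_cases hx : x ∈ tsupport φ
    · simp only [hf1.self_of_nhdsSet x hx, mul_one]
      exact hC x
    · rw [image_eq_zero_of_notMem_tsupport hx, abs_zero]
      exact mul_nonneg ((norm_nonneg _).trans (hC x)) (hf x).1

/-- Differentiation under the integral sign along a one-parameter group. -/
theorem hasDerivAt_integral_comp_mul_right [T2Space G] [SecondCountableTopology G]
    [MeasurableSpace G] [BorelSpace G]
    (P : Measure G) [IsLocallyFiniteMeasure P] {W : GroupLieAlgebra (𝓡 n) G} {γ : ℝ → G}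
    (hγ : IsMIntegralCurve γ (mulInvariantVectorField W)) {φ : G → ℝ}
    (hφ : IsTestFunction n φ) (s : ℝ) :
    HasDerivAt (fun t => ∫ x, φ (x * γ t) ∂P) (∫ x, lieDeriv W φ (x * γ s) ∂P) s := by
  have : IsTopologicalGroup G := topologicalGroup_of_lieGroup (𝓡 n) ∞
  have hγc : Continuous γ := hγ.continuous
  have hW := hφ.lieDeriv W
  obtain ⟨C, hC⟩ := hW.continuous.bounded_above_of_compact_support hW.2
  -- One compact set that carries all the translates `x ↦ φ (x * γ t)` with `|t - s| ≤ 1`.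
  set K : Set G := (fun p : G × ℝ => p.1 * (γ p.2)⁻¹) '' (tsupport φ ×ˢ Metric.closedBall s 1)
  have hK : IsCompact K :=
    (hφ.2.isCompact.prod (isCompact_closedBall s 1)).image
      (continuous_fst.mul (hγc.comp continuous_snd).inv)
  have hmem : ∀ x, ∀ t ∈ Metric.closedBall s 1, x * γ t ∈ tsupport φ → x ∈ K :=
    fun x t ht hx => ⟨(x * γ t, t), ⟨hx, ht⟩, by simp⟩
  refine (hasDerivAt_integral_of_dominated_loc_of_deriv_le
    (s := Metric.closedBall s 1) (bound := K.indicator fun _ => C)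
    (F' := fun t x => lieDeriv W φ (x * γ t)) (Metric.closedBall_mem_nhds s one_pos)
    (.of_forall fun t => (hφ.comp_mul_right (γ t)).continuous.aestronglyMeasurable)
    ((hφ.comp_mul_right (γ s)).integrable P)
    (hW.comp_mul_right (γ s)).continuous.aestronglyMeasurable
    (.of_forall fun x t ht => ?_) ?_
    (.of_forall fun x t _ => hγ.hasDerivAt_comp_mul_left hφ.mdifferentiable x t)).2
  · by_cases hx : x ∈ K
    · simpa [hx] using hC (x * γ t)
    · have h0 : lieDeriv W φ (x * γ t) = 0 := by
        by_contra h
        exact hx (hmem x t ht (support_lieDeriv_subset W φ h))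
      simp [hx, h0]
  · exact (integrable_indicator_iff hK.measurableSet).2
      (integrableOn_const hK.measure_lt_top.ne)

end LieDeriv

end Carnot

/-! ### Affine functions on the real line. -/

theorem eq_zero_of_forall_abs_add_mul_le {a b C : ℝ} (h : ∀ s : ℝ, |a + s * b| ≤ C) : b = 0 := by
  by_contra hb
  have h1 := h ((C + 1 - a) / b)
  rw [div_mul_cancel₀ _ hb, add_sub_cancel] at h1
  linarith [le_abs_self (C + 1)]

theorem eq_add_mul_of_hasDerivAt_of_hasDerivAt_zero {f f' : ℝ → ℝ}
    (hf : ∀ s, HasDerivAt f (f' s) s) (hf' : ∀ s, HasDerivAt f' 0 s) (s : ℝ) :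
    f s = f 0 + s * f' 0 := by
  have hc : ∀ s, f' s = f' 0 := fun s =>
    is_const_of_deriv_eq_zero (fun s => (hf' s).differentiableAt) (fun s => (hf' s).deriv) s 0
  have hg : ∀ s, HasDerivAt (fun s => f s - s * f' 0) 0 s := fun s => by
    have := (hf s).sub ((hasDerivAt_id s).mul_const (f' 0))
    rw [hc s, one_mul, sub_self] at this
    exact this
  have := is_const_of_deriv_eq_zero (fun s => (hg s).differentiableAt) (fun s => (hg s).deriv) s 0
  simp only [zero_mul, sub_zero] at this
  linarith

/-! ### The annihilator of the indicator and the analytic core. -/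

namespace Carnot

variable {n : ℕ} {G : Type*} [TopologicalSpace G] [ChartedSpace (EuclideanSpace ℝ (Fin n)) G]
  [Group G] [MeasurableSpace G] {μ : Measure G} {E : Set G}

theorem indicatorDeriv_smul (c : ℝ) (X : GroupLieAlgebra (𝓡 n) G) (φ : G → ℝ) :
    indicatorDeriv μ E (c • X) φ = c * indicatorDeriv μ E X φ := by
  simp only [indicatorDeriv, lieDeriv_smul, Pi.smul_apply, smul_eq_mul]
  rw [integral_const_mul, mul_neg]

variable [LieGroup (𝓡 n) ∞ G] [BorelSpace G] [IsFiniteMeasureOnCompacts μ]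

theorem indicatorDeriv_add (X Y : GroupLieAlgebra (𝓡 n) G) {φ : G → ℝ} (hφ : IsTestFunction n φ) :
    indicatorDeriv μ E (X + Y) φ = indicatorDeriv μ E X φ + indicatorDeriv μ E Y φ := by
  simp only [indicatorDeriv, lieDeriv_add, Pi.add_apply]
  rw [integral_add ((hφ.lieDeriv X).integrable μ).integrableOn
    ((hφ.lieDeriv Y).integrable μ).integrableOn, neg_add]

theorem indicatorDeriv_lie (X Y : GroupLieAlgebra (𝓡 n) G) {φ : G → ℝ} (hφ : IsTestFunction n φ) :
    indicatorDeriv μ E ⁅X, Y⁆ φ =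
      indicatorDeriv μ E X (lieDeriv Y φ) - indicatorDeriv μ E Y (lieDeriv X φ) := by
  simp only [indicatorDeriv, lieDeriv_lie X Y hφ, Pi.sub_apply]
  rw [integral_sub (((hφ.lieDeriv Y).lieDeriv X).integrable μ).integrableOn
    (((hφ.lieDeriv X).lieDeriv Y).integrable μ).integrableOn]
  ring

variable (n μ E) in
/-- The Lie subalgebra of the left invariant vector fields that annihilate the indicator
of `E`. -/
def indicatorAnnihilator : LieSubalgebra ℝ (GroupLieAlgebra (𝓡 n) G) where
  carrier := {Y | IndicatorDerivEqZero μ E Y}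
  add_mem' {X Y} hX hY φ hφ := by rw [indicatorDeriv_add X Y hφ, hX φ hφ, hY φ hφ, add_zero]
  zero_mem' φ _ := by
    rw [← zero_smul ℝ (0 : GroupLieAlgebra (𝓡 n) G), indicatorDeriv_smul, zero_mul]
  smul_mem' c X hX φ hφ := by rw [indicatorDeriv_smul, hX φ hφ, mul_zero]
  lie_mem' {X Y} hX hY φ hφ := by
    rw [indicatorDeriv_lie X Y hφ, hX _ (hφ.lieDeriv Y), hY _ (hφ.lieDeriv X), sub_zero]

/-- If `Z 𝟙_E` is a multiple of a positive measure, `W 𝟙_E = 0`, and `W` commutes with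
`[Z, W]`, then `[Z, W] 𝟙_E = 0`. -/
theorem indicatorDerivEqZero_lie_of_lie_lie_eq_zero [T2Space G] [SecondCountableTopology G]
    {P : Measure G} [IsLocallyFiniteMeasure P] {Z W : GroupLieAlgebra (𝓡 n) G} {c : ℝ} (hc : c ≠ 0)
    (hZ : ∀ φ : G → ℝ, IsTestFunction n φ → indicatorDeriv μ E Z φ = c * ∫ x, φ x ∂P)
    (hW : IndicatorDerivEqZero μ E W) (hZW : ⁅⁅Z, W⁆, W⁆ = 0) :
    IndicatorDerivEqZero μ E ⁅Z, W⁆ := by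
  obtain ⟨γ, hγ, h0, hadd⟩ := exists_oneParameterSubgroup W
  -- Expand `[[Z, W], W] 𝟙_E = 0`: the terms where `W` falls on `𝟙_E` vanish, and only `c ∫ W²φ dP`
  -- is left.
  have hsecond : ∀ φ : G → ℝ, IsTestFunction n φ →
      ∫ x, lieDeriv W (lieDeriv W φ) x ∂P = 0 := fun φ hφ => by
    have h := (indicatorAnnihilator n μ E).zero_mem φ hφ
    rw [← hZW, indicatorDeriv_lie _ _ hφ, indicatorDeriv_lie _ _ (hφ.lieDeriv W),
      hW _ (hφ.lieDeriv _), hW _ ((hφ.lieDeriv W).lieDeriv Z),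
      hZ _ ((hφ.lieDeriv W).lieDeriv W), sub_zero, sub_zero] at h
    exact (mul_eq_zero.1 h).resolve_left hc
  have haffine : ∀ φ : G → ℝ, IsTestFunction n φ → ∀ s,
      ∫ x, φ (x * γ s) ∂P = ∫ x, φ x ∂P + s * ∫ x, lieDeriv W φ x ∂P := fun φ hφ s => by
    have h := eq_add_mul_of_hasDerivAt_of_hasDerivAt_zero
      (hasDerivAt_integral_comp_mul_right P hγ hφ) (fun s => ?_) s
    · simpa only [h0, mul_one] using h
    · have h := hasDerivAt_integral_comp_mul_right P hγ (hφ.lieDeriv W) s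
      rwa [← lieDeriv_comp_mul_right hγ h0 hadd (hφ.lieDeriv W),
        ← lieDeriv_comp_mul_right hγ h0 hadd hφ, hsecond _ (hφ.comp_mul_right (γ s))] at h
  have hnonneg : ∀ χ : G → ℝ, IsTestFunction n χ → (∀ x, 0 ≤ χ x) →
      ∫ x, lieDeriv W χ x ∂P = 0 := fun χ hχ hpos => by
    by_contra hb
    -- The time at which an affine function of nonzero slope would take the value `-1`.
    have h := haffine χ hχ ((-1 - ∫ x, χ x ∂P) / ∫ x, lieDeriv W χ x ∂P)
    rw [div_mul_cancel₀ _ hb] at h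
    have : 0 ≤ ∫ x, χ (x * γ ((-1 - ∫ x, χ x ∂P) / ∫ x, lieDeriv W χ x ∂P)) ∂P :=
      integral_nonneg fun x => hpos _
    linarith
  intro φ hφ
  rw [indicatorDeriv_lie Z W hφ, hW _ (hφ.lieDeriv Z), hZ _ (hφ.lieDeriv W), sub_zero]
  refine mul_eq_zero_of_right c ?_
  obtain ⟨χ, hχ, hle⟩ := exists_isTestFunction_abs_le hφ
  -- The integral of the translated `χ` does not depend on `s`, so it bounds the affine function of
  -- `φ` for all times.
  refine eq_zero_of_forall_abs_add_mul_le (a := ∫ x, φ x ∂P) (C := ∫ x, χ x ∂P) fun s => ?_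
  have hχs := haffine χ hχ s
  rw [hnonneg χ hχ fun x => (abs_nonneg _).trans (hle x), mul_zero, add_zero] at hχs
  rw [← haffine φ hφ s, ← hχs]
  exact (abs_integral_le_integral_abs).trans
    (integral_mono ((hφ.comp_mul_right (γ s)).integrable P).abs
      ((hχ.comp_mul_right (γ s)).integrable P) fun x => hle _)

end Carnot

/-! ### Generation of the higher layers. -/

section LieAlgebra

variable {L : Type*} [LieRing L] [LieAlgebra ℝ L]

/-- If `ad Z` maps a set into the Lie subalgebra `K` that it generates, it maps `K` into itself. -/
theorem LieSubalgebra.lie_mem_lieSpan_of_forall_mem {s : Set L} {z : L}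
    (h : ∀ w ∈ s, ⁅z, w⁆ ∈ lieSpan ℝ L s) {x : L} (hx : x ∈ lieSpan ℝ L s) :
    ⁅z, x⁆ ∈ lieSpan ℝ L s := by
  induction hx using lieSpan_induction with
  | mem y hy => exact h y hy
  | zero => simp
  | add x y _ _ hx hy => rw [lie_add]; exact add_mem hx hy
  | smul a x _ hx => rw [lie_smul]; exact SMulMemClass.smul_mem a hx
  | lie x y hx' hy' hx hy =>
    rw [leibniz_lie]
    exact add_mem (LieSubalgebra.lie_mem _ hx hy') (LieSubalgebra.lie_mem _ hx' hy)

theorem lie_mem_of_mem_span_left {s : Set L} {K : Submodule ℝ L} {x y : L}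
    (h : ∀ a ∈ s, ⁅a, y⁆ ∈ K) (hx : x ∈ Submodule.span ℝ s) : ⁅x, y⁆ ∈ K := by
  induction hx using Submodule.span_induction with
  | mem x hx => exact h x hx
  | zero => simp
  | add a b _ _ ha hb => rw [add_lie]; exact add_mem ha hb
  | smul c a _ ha => rw [smul_lie]; exact K.smul_mem c ha

/-- In a Lie algebra with layers `V (i + 1) = [V 1, V i]`, suppose that `z` and the `w i` span the
first layer and that `[z, [z, w i]] = 0`. Then a subalgebra that contains all `w i` and `[z, w i]`
contains all layers but the first. -/
theorem LieSubalgebra.layer_le_of_lie_lie_eq_zero {ι : Type*} {V : ℕ → Submodule ℝ L}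
    (hV : ∀ i, 1 ≤ i → Submodule.span ℝ {z | ∃ x ∈ V 1, ∃ y ∈ V i, ⁅x, y⁆ = z} = V (i + 1))
    (A : LieSubalgebra ℝ L) {z : L} {w : ι → L}
    (hspan : V 1 ≤ Submodule.span ℝ (insert z (Set.range w)))
    (hzw : ∀ i, ⁅z, ⁅z, w i⁆⁆ = 0) (hw : ∀ i, w i ∈ A) (hzwA : ∀ i, ⁅z, w i⁆ ∈ A) (i : ℕ)
    (hi : 2 ≤ i) : V i ≤ A.toSubmodule := by
  set s : Set L := Set.range w ∪ Set.range fun i => ⁅z, w i⁆ with hs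
  set K := lieSpan ℝ L s with hK
  have hKA : K ≤ A := by
    rw [hK, lieSpan_le, hs, Set.union_subset_iff, Set.range_subset_iff, Set.range_subset_iff]
    exact ⟨hw, hzwA⟩
  have hwK : ∀ i, w i ∈ K := fun i => subset_lieSpan (Or.inl ⟨i, rfl⟩)
  have hzwK : ∀ i, ⁅z, w i⁆ ∈ K := fun i => subset_lieSpan (Or.inr ⟨i, rfl⟩)
  -- On generators, `ad z` sends `w i` to `[z, w i]` and `[z, w i]` to `0`.
  have hzK : ∀ x ∈ K, ⁅z, x⁆ ∈ K := fun x hx => by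
    refine lie_mem_lieSpan_of_forall_mem ?_ hx
    rintro _ (⟨i, rfl⟩ | ⟨i, rfl⟩)
    · exact hzwK i
    · simp only [hzw i]
      exact zero_mem _
  have hV1K : ∀ x ∈ V 1, ∀ y ∈ K, ⁅x, y⁆ ∈ K := fun x hx y hy => by
    refine lie_mem_of_mem_span_left (K := K.toSubmodule) ?_ (hspan hx)
    rintro _ (rfl | ⟨i, rfl⟩)
    · exact hzK y hy
    · exact K.lie_mem (hwK i) hy
  have hzV1 : ∀ y ∈ V 1, ⁅z, y⁆ ∈ K := fun y hy => by
    rw [← lie_skew]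
    refine neg_mem (lie_mem_of_mem_span_left (K := K.toSubmodule) ?_ (hspan hy))
    rintro _ (rfl | ⟨i, rfl⟩)
    · simp
    · rw [← lie_skew]
      exact neg_mem (hzwK i)
  -- Needs its own argument, since `z`, and with it `V 1`, need not lie in `K`.
  have hV1V1 : ∀ x ∈ V 1, ∀ y ∈ V 1, ⁅x, y⁆ ∈ K := fun x hx y hy => by
    refine lie_mem_of_mem_span_left (K := K.toSubmodule) ?_ (hspan hx)
    rintro _ (rfl | ⟨i, rfl⟩)
    · exact hzV1 y hy
    · rw [← lie_skew]
      exact neg_mem (hV1K y hy _ (hwK i))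
  refine le_trans ?_ hKA
  induction i, hi using Nat.le_induction with
  | base =>
    rw [← hV 1 le_rfl, Submodule.span_le]
    rintro _ ⟨x, hx, y, hy, rfl⟩
    exact hV1V1 x hx y hy
  | succ i hi ih =>
    rw [← hV i (by omega), Submodule.span_le]
    rintro _ ⟨x, hx, y, hy, rfl⟩
    exact hV1K x hx y (ih hy)

end LieAlgebra

/-! ### Constant normals as linear forms, and the conclusion. -/

namespace Carnot

variable {n : ℕ} {G : Type*} [TopologicalSpace G] [ChartedSpace (EuclideanSpace ℝ (Fin n)) G]
  [Group G] [LieGroup (𝓡 n) ∞ G] [MeasurableSpace G] [BorelSpace G]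
  {μ : Measure G} [IsFiniteMeasureOnCompacts μ] {E : Set G}

/-- For a set with constant intrinsic normal, the horizontal derivatives of the indicator are
multiples of one positive measure. -/
theorem HasConstantIntrinsicNormal.exists_linearMap {m : ℕ}
    {V : ℕ → Submodule ℝ (GroupLieAlgebra (𝓡 n) G)} {X : Module.Basis (Fin m) ℝ (V 1)}
    (hE : HasConstantIntrinsicNormal μ V X E) :
    ∃ (P : Measure G) (l : V 1 →ₗ[ℝ] ℝ), IsLocallyFiniteMeasure P ∧ l ≠ 0 ∧
      ∀ (Y : V 1) (φ : G → ℝ), IsTestFunction n φ →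
        indicatorDeriv μ E (Y : GroupLieAlgebra (𝓡 n) G) φ = l Y * ∫ x, φ x ∂P := by
  obtain ⟨-, P, ν, hP, hP0, ⟨-, hν1, hν⟩, v, hv⟩ := hE
  refine ⟨P, X.constr ℝ fun i => v i, hP.1, fun h => ?_, fun Y φ hφ => ?_⟩
  -- As `P ≠ 0`, some point has `ν x = v` and `‖ν x‖ = 1`, so `v ≠ 0`.
  · have : (ae P).NeBot := ae_neBot.2 hP0
    obtain ⟨x, hx1, hx⟩ := (hν1.and hv).exists
    have hv0 : v = 0 := by
      ext i
      simpa using LinearMap.congr_fun h (X i)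
    simp [hx, hv0] at hx1
  · let T : V 1 →ₗ[ℝ] ℝ :=
      { toFun := fun Y => indicatorDeriv μ E (Y : GroupLieAlgebra (𝓡 n) G) φ
        map_add' := fun Y Y' => indicatorDeriv_add _ _ hφ
        map_smul' := fun c Y => indicatorDeriv_smul c _ φ }
    have hT : T = (∫ x, φ x ∂P) • X.constr ℝ fun i => v i := by
      refine X.ext fun i => ?_
      have h : T (X i) = ∫ x, φ x * ν x i ∂P := hν i φ hφ
      have h' : ∫ x, φ x * ν x i ∂P = ∫ x, φ x * v i ∂P :=
        integral_congr_ae (hv.mono fun x hx => by simp only [hx])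
      rw [h, h', integral_mul_const]
      simp
    have := LinearMap.congr_fun hT Y
    rw [mul_comm]
    exact this

end Carnot

theorem theorem3p7 {n : ℕ} {G : Type*} [TopologicalSpace G] [T2Space G]
    [SecondCountableTopology G] [ChartedSpace (EuclideanSpace ℝ (Fin n)) G] [Group G]
    [LieGroup (𝓡 n) ∞ G] [MeasurableSpace G] [BorelSpace G]
    (μ : Measure G) [μ.IsHaarMeasure]
    (κ : ℕ) (V : ℕ → Submodule ℝ (GroupLieAlgebra (𝓡 n) G))
    (hG : Carnot.IsCarnotGroup κ V) (hstar : Carnot.IsTypeStar V)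
    {m : ℕ} (X : Module.Basis (Fin m) ℝ (V 1))
    (E : Set G) (hE : Carnot.HasConstantIntrinsicNormal μ V X E) :
    Carnot.IsVerticalHalfspace μ κ V X E := by
  refine ⟨hE, ?_⟩
  suffices h : ∀ i, 2 ≤ i → V i ≤ (Carnot.indicatorAnnihilator n μ E).toSubmodule from
    fun Y hY => iSup₂_le (fun i hi => h i hi.1) hY
  obtain ⟨P, l, hP, hl, hlP⟩ := hE.exists_linearMap
  obtain ⟨d, Z, hZ⟩ := hstar
  obtain ⟨k, hk⟩ : ∃ k, l (Z k) ≠ 0 := by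
    by_contra! h
    exact hl (Z.ext fun i => by simp [h i])
  set w : Fin d → V 1 := fun i => l (Z k) • Z i - l (Z i) • Z k with hw
  have hlw : ∀ i, l (w i) = 0 := fun i => by simp [hw, mul_comm]
  have hwL : ∀ i, (w i : GroupLieAlgebra (𝓡 n) G) =
      l (Z k) • (Z i : GroupLieAlgebra (𝓡 n) G) - l (Z i) • (Z k : GroupLieAlgebra (𝓡 n) G) :=
    fun i => rfl
  have hzw : ∀ i, ⁅(Z k : GroupLieAlgebra (𝓡 n) G), (w i : GroupLieAlgebra (𝓡 n) G)⁆ =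
      l (Z k) • ⁅(Z k : GroupLieAlgebra (𝓡 n) G), (Z i : GroupLieAlgebra (𝓡 n) G)⁆ := fun i => by
    rw [hwL, lie_sub, lie_smul, lie_smul, lie_self, smul_zero, sub_zero]
  have hwA : ∀ i, Carnot.IndicatorDerivEqZero μ E (w i : GroupLieAlgebra (𝓡 n) G) :=
    fun i φ hφ => by rw [hlP (w i) φ hφ, hlw, zero_mul]
  have hspan : V 1 ≤ Submodule.span ℝ (insert (Z k : GroupLieAlgebra (𝓡 n) G)
      (Set.range fun i => (w i : GroupLieAlgebra (𝓡 n) G))) := by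
    have hle : Submodule.span ℝ (Set.range Z) ≤ (Submodule.span ℝ
        (insert (Z k : GroupLieAlgebra (𝓡 n) G)
          (Set.range fun i => (w i : GroupLieAlgebra (𝓡 n) G)))).comap (V 1).subtype := by
      rw [Submodule.span_le]
      rintro _ ⟨i, rfl⟩
      have h : (Z i : GroupLieAlgebra (𝓡 n) G) =
          (l (Z k))⁻¹ • ((w i : GroupLieAlgebra (𝓡 n) G) + l (Z i) • (Z k : _)) := by
        rw [hwL, sub_add_cancel, inv_smul_smul₀ hk]
      rw [SetLike.mem_coe, Submodule.mem_comap, Submodule.subtype_apply, h]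
      exact Submodule.smul_mem _ _ (add_mem (Submodule.subset_span (Or.inr ⟨i, rfl⟩))
        (Submodule.smul_mem _ _ (Submodule.subset_span (Or.inl rfl))))
    intro y hy
    exact hle (by rw [Z.span_eq]; trivial : (⟨y, hy⟩ : V 1) ∈ _)
  refine LieSubalgebra.layer_le_of_lie_lie_eq_zero hG.isStratification.bracket_eq _ hspan
    (fun i => ?_) hwA fun i => ?_
  · rw [hzw, lie_smul, hZ, smul_zero]
  · refine Carnot.indicatorDerivEqZero_lie_of_lie_lie_eq_zero hk (hlP (Z k)) (hwA i) ?_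
    -- Expanding `[[Z_k, w_i], w_i]` leaves two double brackets. Type `⋆` kills both: here with
    -- `Z_i` acting twice on `Z_k`, in `h2` with `Z_k` acting twice on `Z_i`.
    have h1 : ⁅⁅(Z k : GroupLieAlgebra (𝓡 n) G), (Z i : GroupLieAlgebra (𝓡 n) G)⁆,
        (Z i : GroupLieAlgebra (𝓡 n) G)⁆ = 0 := by
      rw [← lie_skew, ← lie_skew (Z k : GroupLieAlgebra (𝓡 n) G), lie_neg, hZ, neg_zero, neg_zero]
    have h2 : ⁅⁅(Z k : GroupLieAlgebra (𝓡 n) G), (Z i : GroupLieAlgebra (𝓡 n) G)⁆,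
        (Z k : GroupLieAlgebra (𝓡 n) G)⁆ = 0 := by
      rw [← lie_skew, hZ, neg_zero]
    rw [hzw, hwL, smul_lie, lie_sub, lie_smul, lie_smul, h1, h2, smul_zero, smul_zero, sub_zero,
      smul_zero]
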